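/- Let $n\ge 0$ be an integer and let $a_0,\dots,a_n>0$ be pairwise distinct real numbers. On the unit sphere $S^n=\{q\in\mathbb{R}^{n+1} : \sum_\alpha q_\alpha^2=1\}$ consider the Riemannian metric $$\mathrm{g}_2=\frac{\sum_{\alpha=0}^n dq_\alpha^2}{\sum_{\alpha=0}^n q_\alpha^2/a_\alpha}\Big|_{S^n}.$$ Identify $T^*S^n$ with $\{(q,p)\in\mathbb{R}^{n+1}\times\mathbb{R}^{n+1} : \sum_\alpha q_\alpha^2=1,\ \sum_\alpha p_\alpha q_\alpha=0\}$, where $(q,p)$ represents the covector $u\mapsto\sum_\alpha p_\alpha u_\alpha$ on $T_qS^n$, with symplectic form the restriction of $\sum_\alpha dp_\alpha\wedge dq_\alpha$. The Hamiltonian of the geodesic flow of $(S^n,\mathrm{g}_2)$, namely $H(q,p)=\frac12\,\mathrm{g}_2^{-1}(p,p)$, is then the restriction to $T^*S^n$ of $\frac12\big(\sum_\alpha q_\alpha^2/a_\alpha\big)\sum_\alpha p_\alpha^2$; the geodesic flow on $T^*S^n$ is the Hamiltonian flow of $H$. For $\alpha=0,\dots,n$ put $$F_\alpha=q_\alpha^2\sum_{\beta=0}^n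 a_\beta p_\beta^2+\sum_{\beta\ne\alpha}\frac{(a_\alpha p_\alpha q_\beta-a_\beta p_\beta q_\alpha)^2}{a_\alpha-a_\beta}.$$ Then the geodesic flow of $(S^n,\mathrm{g}_2)$ on $T^*S^n$ is Liouville-integrable, that is, it has $n$ smooth first integrals which pairwise Poisson-commute on $T^*S^n$ and whose differentials are linearly independent at every point of a dense open subset of $T^*S^n$. More precisely, the restrictions of $F_0,\dots,F_n$ to $T^*S^n$ are first integrals of the geodesic flow, they pairwise Poisson-commute on $T^*S^n$, and for every $\gamma\in\{0,\dots,n\}$ the $n$ functions $(F_\alpha)_{\alpha\neq\gamma}$ are such a system of first integrals. -/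

import Mathlib

open scoped ContDiff

/-- Points `(q, p)` of `T*ℝⁿ⁺¹ = ℝⁿ⁺¹ × ℝⁿ⁺¹`; also used for tangent vectors `(q̇, ṗ)` to it. -/
abbrev Phase (n : ℕ) : Type := (Fin (n + 1) → ℝ) × (Fin (n + 1) → ℝ)

/-- The cotangent bundle `T*Sⁿ`, embedded in `T*ℝⁿ⁺¹` by the constraints `∑ q_α² = 1` and
`∑ p_α q_α = 0`: a covector on `T_q Sⁿ = q^⊥` is represented by the unique `p ⟂ q` such that the
covector is `u ↦ ∑ p_α u_α`. -/
def CotangentSphere (n : ℕ) : Set (Phase n) :=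
  {x | ∑ α, x.1 α ^ 2 = 1 ∧ ∑ α, x.2 α * x.1 α = 0}

/-- The tangent space of `T*Sⁿ` at `x = (q, p)`: the vectors `(u, w)` killed by the differentials
of the two constraints. -/
def tangentCotangentSphere {n : ℕ} (x : CotangentSphere n) : Submodule ℝ (Phase n) where
  carrier := {Y | ∑ α, x.1.1 α * Y.1 α = 0 ∧ ∑ α, (x.1.1 α * Y.2 α + x.1.2 α * Y.1 α) = 0}
  add_mem' := by
    rintro Y Z ⟨h1, h2⟩ ⟨h3, h4⟩
    constructor
    · simp only [Prod.fst_add, Pi.add_apply, mul_add, Finset.sum_add_distrib, h1, h3, add_zero]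
    · have h : ∑ α, ((x.1.1 α * Y.2 α + x.1.2 α * Y.1 α) +
          (x.1.1 α * Z.2 α + x.1.2 α * Z.1 α)) = 0 := by
        rw [Finset.sum_add_distrib, h2, h4, add_zero]
      rw [← h]
      refine Finset.sum_congr rfl fun α _ => ?_
      simp only [Prod.fst_add, Prod.snd_add, Pi.add_apply]
      ring
  zero_mem' := by simp
  smul_mem' := by
    rintro c Y ⟨h1, h2⟩
    constructor
    · rw [← mul_zero c, ← h1, Finset.mul_sum]
      refine Finset.sum_congr rfl fun α _ => ?_
      simp only [Prod.smul_fst, Pi.smul_apply, smul_eq_mul]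
      ring
    · rw [← mul_zero c, ← h2, Finset.mul_sum]
      refine Finset.sum_congr rfl fun α _ => ?_
      simp only [Prod.smul_fst, Prod.smul_snd, Pi.smul_apply, smul_eq_mul]
      ring

/-- The canonical symplectic form `∑ dp_α ∧ dq_α` of `T*ℝⁿ⁺¹`. -/
def canonicalForm (n : ℕ) : LinearMap.BilinForm ℝ (Phase n) :=
  LinearMap.mk₂ ℝ (fun X Y => ∑ α, (X.2 α * Y.1 α - Y.2 α * X.1 α))
    (by intro X X' Y
        rw [← Finset.sum_add_distrib]
        refine Finset.sum_congr rfl fun α _ => ?_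
        simp only [Prod.fst_add, Prod.snd_add, Pi.add_apply]; ring)
    (by intro c X Y
        rw [smul_eq_mul, Finset.mul_sum]
        refine Finset.sum_congr rfl fun α _ => ?_
        simp only [Prod.smul_fst, Prod.smul_snd, Pi.smul_apply, smul_eq_mul]; ring)
    (by intro X Y Y'
        rw [← Finset.sum_add_distrib]
        refine Finset.sum_congr rfl fun α _ => ?_
        simp only [Prod.fst_add, Prod.snd_add, Pi.add_apply]; ring)
    (by intro c X Y
        rw [smul_eq_mul, Finset.mul_sum]
        refine Finset.sum_congr rfl fun α _ => ?_
        simp only [Prod.smul_fst, Prod.smul_snd, Pi.smul_apply, smul_eq_mul]; ring)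

/-- The symplectic form of `T*Sⁿ` at `x`: the restriction of `∑ dp_α ∧ dq_α`. -/
def symplecticForm {n : ℕ} (x : CotangentSphere n) :
    LinearMap.BilinForm ℝ (tangentCotangentSphere x) :=
  (canonicalForm n).restrict (tangentCotangentSphere x)

theorem symplecticForm_apply {n : ℕ} (x : CotangentSphere n) (X Y : tangentCotangentSphere x) :
    symplecticForm x X Y = ∑ α, (X.1.2 α * Y.1.1 α - Y.1.2 α * X.1.1 α) := rfl

theorem symplecticForm_nondegenerate {n : ℕ} (x : CotangentSphere n) :
    (symplecticForm x).Nondegenerate := by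
  have key : ∀ X : tangentCotangentSphere x,
      (∀ Y, symplecticForm x X Y = 0) → X = 0 := by
    intro X hX
    obtain ⟨hq, hp⟩ := x.2
    obtain ⟨⟨u, w⟩, h1, h2⟩ := X
    simp only [symplecticForm_apply] at hX
    simp only at h1 h2
    have hu : u = 0 := by
      have := hX ⟨(0, u), by simp, by simpa using h1⟩
      simp only [Pi.zero_apply, mul_zero, zero_sub, Finset.sum_neg_distrib, neg_eq_zero] at this
      funext α
      have h := (Finset.sum_eq_zero_iff_of_nonneg
        (fun α _ => mul_self_nonneg (u α))).1 this α (Finset.mem_univ α)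
      exact mul_self_eq_zero.1 h
    subst hu
    simp only [Pi.zero_apply, mul_zero, add_zero] at h2
    have hw : w = 0 := by
      have := hX ⟨(w, fun α => -(∑ β, x.1.2 β * w β) * x.1.1 α), h2, by
        simp only [Finset.sum_add_distrib]
        have : ∑ α, x.1.1 α * (-(∑ β, x.1.2 β * w β) * x.1.1 α)
            = -(∑ β, x.1.2 β * w β) * ∑ α, x.1.1 α ^ 2 := by
          rw [Finset.mul_sum]
          exact Finset.sum_congr rfl fun α _ => by ring
        rw [this, hq]
        ring⟩
      simp only [Pi.zero_apply, mul_zero, sub_zero] at this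
      funext α
      have h := (Finset.sum_eq_zero_iff_of_nonneg
        (fun α _ => mul_self_nonneg (w α))).1 this α (Finset.mem_univ α)
      exact mul_self_eq_zero.1 h
    subst hw
    rfl
  refine ⟨key, fun Y hY => key Y fun X => ?_⟩
  have h := hY X
  rw [symplecticForm_apply] at h ⊢
  rw [← neg_eq_zero, ← Finset.sum_neg_distrib, ← h]
  exact Finset.sum_congr rfl fun α _ => by ring

/-- The differential at `x` of the restriction to `T*Sⁿ` of a function `f` on `T*ℝⁿ⁺¹`. -/
noncomputable def restrictedDifferential {n : ℕ} (f : Phase n → ℝ) (x : CotangentSphere n) :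
    Module.Dual ℝ (tangentCotangentSphere x) :=
  (fderiv ℝ f x.1).toLinearMap.domRestrict (tangentCotangentSphere x)

/-- The Hamiltonian vector field `X_f` on `T*Sⁿ` of (the restriction of) `f`: the tangent vector
field with `ω(X_f, ·) = -df`. -/
noncomputable def hamiltonianVector {n : ℕ} (f : Phase n → ℝ) (x : CotangentSphere n) :
    tangentCotangentSphere x :=
  ((symplecticForm x).toDual (symplecticForm_nondegenerate x)).symm (-restrictedDifferential f x)

/-- The Poisson bracket on `T*Sⁿ`, `{f, g} = X_f(g) = ω(X_f, X_g)`, of the restrictions of two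
functions. -/
noncomputable def poissonBracket {n : ℕ} (f g : Phase n → ℝ) (x : CotangentSphere n) : ℝ :=
  symplecticForm x (hamiltonianVector f x) (hamiltonianVector g x)

/-- `γ` restricted to the time interval `(s, t)` is a trajectory in `T*Sⁿ` of the Hamiltonian
flow of `H`. -/
def IsTrajectory {n : ℕ} (H : Phase n → ℝ) (γ : ℝ → CotangentSphere n) (s t : ℝ) : Prop :=
  ∀ τ ∈ Set.Ioo s t,
    HasDerivAt (fun r => (γ r : Phase n)) (hamiltonianVector H (γ τ) : Phase n) τ

/-- `f` is a first integral of the Hamiltonian flow of `H` on `T*Sⁿ`: its derivative along the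
Hamiltonian vector field vanishes, and it is constant along all trajectories. -/
def IsFirstIntegral {n : ℕ} (H f : Phase n → ℝ) : Prop :=
  (∀ x : CotangentSphere n, restrictedDifferential f x (hamiltonianVector H x) = 0) ∧
  ∀ (γ : ℝ → CotangentSphere n) (s t : ℝ), IsTrajectory H γ s t →
    ∀ τ ∈ Set.Ioo s t, ∀ τ' ∈ Set.Ioo s t, f (γ τ) = f (γ τ')

/-- The functions `I i` are functionally independent on `T*Sⁿ`: their differentials are linearly
independent at all points of a dense open subset of `T*Sⁿ`. -/
def FunctionallyIndependent {n : ℕ} {ι : Type} (I : ι → Phase n → ℝ) : Prop :=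
  ∃ U : Set (CotangentSphere n), IsOpen U ∧ Dense U ∧
    ∀ x ∈ U, LinearIndependent ℝ (fun i => restrictedDifferential (I i) x)

/-- The Hamiltonian flow of `H` on the `2n`-dimensional symplectic manifold `T*Sⁿ` is
Liouville-integrable by means of `I`: `H` is smooth, and the `n` smooth functions `I 0, …, I (n-1)` are first
integrals in involution, and functionally independent. -/
structure IsLiouvilleIntegrableBy {n : ℕ} (H : Phase n → ℝ) (I : Fin n → Phase n → ℝ) : Prop where
  smooth_hamiltonian : ContDiff ℝ ∞ H
  smooth : ∀ i, ContDiff ℝ ∞ (I i)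
  firstIntegral : ∀ i, IsFirstIntegral H (I i)
  involution : ∀ i j, ∀ x : CotangentSphere n, poissonBracket (I i) (I j) x = 0
  independent : FunctionallyIndependent I

/-- Liouville integrability of the Hamiltonian flow of `H` on `T*Sⁿ`. -/
def IsLiouvilleIntegrable {n : ℕ} (H : Phase n → ℝ) : Prop :=
  ∃ I : Fin n → Phase n → ℝ, IsLiouvilleIntegrableBy H I

/-- The conformally flat metric `(∑ dq_α²) / (∑ q_α² / a_α)`, evaluated at `q` on `u` and `v`. -/
noncomputable def conformalMetric {n : ℕ} (a : Fin (n + 1) → ℝ) (q u v : Fin (n + 1) → ℝ) : ℝ :=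
  (∑ α, u α * v α) / (∑ α, q α ^ 2 / a α)

/-- `H` is on `T*Sⁿ` the Hamiltonian of the geodesic flow of `(Sⁿ, g₂)`, where `g₂` is the
restriction of the conformally flat metric: `H(q, p) = g₂(v, v) / 2`, where `v ∈ T_q Sⁿ` is the
vector that `g₂` associates with the covector `p`. -/
def IsGeodesicHamiltonian {n : ℕ} (a : Fin (n + 1) → ℝ) (H : Phase n → ℝ) : Prop :=
  ∀ x : CotangentSphere n, ∃ v : Fin (n + 1) → ℝ, ∑ α, x.1.1 α * v α = 0 ∧
    (∀ u : Fin (n + 1) → ℝ, ∑ α, x.1.1 α * u α = 0 →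
      conformalMetric a x.1.1 v u = ∑ α, x.1.2 α * u α) ∧
    H x = conformalMetric a x.1.1 v v / 2

/-- The function `H = ½ (∑ q_α² / a_α) ∑ p_α²`. -/
noncomputable def dualMoserHamiltonian {n : ℕ} (a : Fin (n + 1) → ℝ) (x : Phase n) : ℝ :=
  1 / 2 * (∑ α, x.1 α ^ 2 / a α) * ∑ α, x.2 α ^ 2

/-- The functions `F_α` of the dual Moser system. -/
noncomputable def dualMoser {n : ℕ} (a : Fin (n + 1) → ℝ) (α : Fin (n + 1)) (x : Phase n) : ℝ :=
  x.1 α ^ 2 * ∑ β, a β * x.2 β ^ 2 +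
    ∑ β ∈ Finset.univ.erase α,
      (a α * x.2 α * x.1 β - a β * x.2 β * x.1 α) ^ 2 / (a α - a β)

/-! All the `F_α` are packed into the rational function `∑ F_α / (z - a_α)`, which collapses to `P T
- R²` with `P = ∑ q_α² / (z - a_α)`, `T = z ∑ a_α p_α² / (z - a_α)`, `R = ∑ a_α q_α p_α / (z - a_α)`
(`sum_inv_sub_mul_dualMoser`). Its Hamiltonian field on `T*Sⁿ` is explicit, and partial fractions
show that its values at `z ≠ w` commute (`poissonBracket_generating`). Linear independence of the
functions `1 / (z - a_α)` then separates the individual brackets.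

The Hamiltonian is half the `z`-derivative of this function at `0`, up to a product whose
differential vanishes on `T*Sⁿ` (`dualMoserHamiltonian_eq`). Hence `dH` is a combination of the
`dF_α`, and involution makes every `F_α` a first integral.

For independence, the `F_α` with `α ≠ γ` are differentiated in fibre directions only. The resulting
determinant is nonzero at `q = e_γ` for suitable `p`; analyticity along a line from an arbitrary
point to such a point gives density. -/

/-! ### Hamiltonian calculus on `T*Sⁿ` and general tools. -/

theorem hamiltonianVector_eq {n : ℕ} {f : Phase n → ℝ} {x : CotangentSphere n}
    {X : tangentCotangentSphere x}
    (h : ∀ Y : tangentCotangentSphere x, symplecticForm x X Y = -fderiv ℝ f x.1 Y) :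
    hamiltonianVector f x = X := by
  unfold hamiltonianVector
  rw [LinearEquiv.symm_apply_eq]
  ext Y
  rw [LinearMap.BilinForm.toDual_def, h]
  rfl

theorem symplecticForm_hamiltonianVector {n : ℕ} (f : Phase n → ℝ) (x : CotangentSphere n)
    (Y : tangentCotangentSphere x) :
    symplecticForm x (hamiltonianVector f x) Y = -restrictedDifferential f x Y := by
  unfold hamiltonianVector
  rw [LinearMap.BilinForm.apply_toDual_symm_apply]
  rfl

theorem hamiltonianVector_eq_sum {n : ℕ} {ι : Type*} (s : Finset ι) (c : ι → ℝ)
    (f : Phase n → ℝ) (F : ι → Phase n → ℝ) (x : CotangentSphere n)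
    (h : restrictedDifferential f x = ∑ i ∈ s, c i • restrictedDifferential (F i) x) :
    hamiltonianVector f x = ∑ i ∈ s, c i • hamiltonianVector (F i) x := by
  refine hamiltonianVector_eq fun Y => ?_
  change _ = -restrictedDifferential f x Y
  simp [h, symplecticForm_hamiltonianVector]

theorem restrictedDifferential_sum {n : ℕ} {ι : Type*} (s : Finset ι) (c : ι → ℝ)
    (F : ι → Phase n → ℝ) (hF : ∀ i, Differentiable ℝ (F i)) (x : CotangentSphere n) :
    restrictedDifferential (fun y => ∑ i ∈ s, c i * F i y) x =
      ∑ i ∈ s, c i • restrictedDifferential (F i) x := by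
  ext Y
  simp only [restrictedDifferential, LinearMap.domRestrict_apply, LinearMap.sum_apply,
    LinearMap.smul_apply, ContinuousLinearMap.coe_coe]
  rw [fderiv_fun_sum fun i _ => ((hF i).differentiableAt.const_mul (c i))]
  simp [fderiv_const_mul (hF _).differentiableAt]

/-- If `f` has zero derivative along the Hamiltonian vector field, it is a first integral. -/
theorem isFirstIntegral_of_differential {n : ℕ} {H f : Phase n → ℝ} (hf : Differentiable ℝ f)
    (h : ∀ x : CotangentSphere n, restrictedDifferential f x (hamiltonianVector H x) = 0) :
    IsFirstIntegral H f := by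
  refine ⟨h, fun γ s t hγ τ hτ τ' hτ' => ?_⟩
  have hd : ∀ r ∈ Set.Ioo s t, HasDerivAt (fun r => f (γ r)) 0 r := fun r hr => by
    have := (hf (γ r : Phase n)).hasFDerivAt.comp_hasDerivAt r (hγ r hr)
    rwa [show fderiv ℝ f (γ r : Phase n) (hamiltonianVector H (γ r) : Phase n) = 0 from
      h (γ r)] at this
  exact isOpen_Ioo.is_const_of_deriv_eq_zero isPreconnected_Ioo
    (fun r hr => (hd r hr).differentiableAt.differentiableWithinAt)
    (fun r hr => (hd r hr).deriv) hτ hτ'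

theorem fderiv_eq_of_line {n : ℕ} {f : Phase n → ℝ} (hf : Differentiable ℝ f) {x Y : Phase n}
    {d : ℝ} (h : HasDerivAt (fun t : ℝ => f (x + t • Y)) d 0) : fderiv ℝ f x Y = d := by
  rw [← (hf x).lineDeriv_eq_fderiv]
  exact HasLineDerivAt.lineDeriv h

/-- Along a line, `P`, `T`, `R`, `∑ p_α q_α` and, for fixed `q`, the sums in `F_α` are all weighted
sums of products of two affine functions of `t`. -/
theorem hasDerivAt_sum_mul_line {ι : Type*} (s : Finset ι) (c u u' v v' : ι → ℝ) :
    HasDerivAt (fun t : ℝ => ∑ i ∈ s, c i * ((u i + t * u' i) * (v i + t * v' i)))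
      (∑ i ∈ s, c i * (u' i * v i + u i * v' i)) 0 := by
  refine HasDerivAt.fun_sum fun i _ => HasDerivAt.const_mul _ ?_
  have h (b b' : ℝ) : HasDerivAt (fun t : ℝ => b + t * b') b' 0 := by
    simpa using ((hasDerivAt_id (0 : ℝ)).mul_const b').const_add b
  simpa using (h (u i) (u' i)).fun_mul (h (v i) (v' i))

/-- The functions `z ↦ 1 / (z - a i)` are linearly independent on cofinite sets. -/
theorem eq_zero_of_sum_inv_sub_mul {ι : Type*} [Fintype ι] {a : ι → ℝ}
    (ha : Function.Injective a) (c : ι → ℝ) {S : Set ℝ} (hS : S.Finite)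
    (hc : ∀ z, z ∉ S → (∀ i, z ≠ a i) → ∑ i, (z - a i)⁻¹ * c i = 0) (i : ι) : c i = 0 := by
  classical
  -- The relation with denominators cleared; at `a i` only the `i`-th summand survives.
  let P : Polynomial ℝ := ∑ i, Polynomial.C (c i) *
    ∏ j ∈ Finset.univ.erase i, (Polynomial.X - Polynomial.C (a j))
  have hP : P = 0 := by
    refine Polynomial.eq_zero_of_infinite_isRoot _
      ((hS.union (Set.finite_range a)).infinite_compl.mono fun z hz => ?_)
    simp only [Set.mem_compl_iff, Set.mem_union, Set.mem_range, not_or, not_exists] at hz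
    have hne : ∀ i, z ≠ a i := fun i h => hz.2 i h.symm
    have h := hc z hz.1 hne
    simp only [Set.mem_ofPred_eq, Polynomial.IsRoot.def, P, Polynomial.eval_finsetSum,
      Polynomial.eval_mul, Polynomial.eval_C, Polynomial.eval_prod, Polynomial.eval_sub,
      Polynomial.eval_X]
    rw [← mul_zero (∏ j, (z - a j)), ← h, Finset.mul_sum]
    refine Finset.sum_congr rfl fun i _ => ?_
    rw [← Finset.mul_prod_erase _ _ (Finset.mem_univ i)]
    have := sub_ne_zero.2 (hne i)
    field_simp
  have h := congrArg (Polynomial.eval (a i)) hP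
  simp only [P, Polynomial.eval_finsetSum, Polynomial.eval_mul, Polynomial.eval_C,
    Polynomial.eval_prod, Polynomial.eval_sub, Polynomial.eval_X, Polynomial.eval_zero] at h
  rw [Finset.sum_eq_single i] at h
  · refine (mul_eq_zero.1 h).resolve_right (Finset.prod_ne_zero_iff.2 fun j hj => ?_)
    exact sub_ne_zero.2 fun e => (Finset.mem_erase.1 hj).1 (ha e).symm
  · intro j _ hj
    rw [Finset.prod_eq_zero (Finset.mem_erase.2 ⟨hj.symm, Finset.mem_univ i⟩) (sub_self _),
      mul_zero]
  · simp

/-! ### Smoothness and the geodesic Hamiltonian. -/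

theorem contDiff_dualMoser {n : ℕ} (a : Fin (n + 1) → ℝ) (α : Fin (n + 1)) :
    ContDiff ℝ ∞ (dualMoser a α) := by
  unfold dualMoser
  fun_prop

theorem differentiable_dualMoser {n : ℕ} (a : Fin (n + 1) → ℝ) (α : Fin (n + 1)) :
    Differentiable ℝ (dualMoser a α) :=
  (contDiff_dualMoser a α).differentiable (by simp)

theorem contDiff_dualMoserHamiltonian {n : ℕ} (a : Fin (n + 1) → ℝ) :
    ContDiff ℝ ∞ (dualMoserHamiltonian a) := by
  unfold dualMoserHamiltonian
  fun_prop

theorem isGeodesicHamiltonian_dualMoserHamiltonian {n : ℕ} {a : Fin (n + 1) → ℝ}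
    (ha : ∀ α, 0 < a α) : IsGeodesicHamiltonian a (dualMoserHamiltonian a) := by
  rintro ⟨⟨q, p⟩, hq, hp⟩
  simp only at hq hp
  have hpos : 0 < ∑ α, q α ^ 2 / a α := by
    have h0 : ∀ α ∈ Finset.univ, 0 ≤ q α ^ 2 / a α :=
      fun α _ => div_nonneg (sq_nonneg _) (ha α).le
    refine (Finset.sum_nonneg h0).lt_of_ne fun h => ?_
    have h1 := (Finset.sum_eq_zero_iff_of_nonneg h0).1 h.symm
    have h2 : ∑ α, q α ^ 2 = 0 := Finset.sum_eq_zero fun α hα =>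
      (div_eq_zero_iff.1 (h1 α hα)).resolve_right (ha α).ne'
    linarith
  refine ⟨fun α => (∑ β, q β ^ 2 / a β) * p α, ?_, fun u _ => ?_, ?_⟩
  · refine Eq.trans ?_ (mul_eq_zero_of_right (∑ β, q β ^ 2 / a β) hp)
    rw [Finset.mul_sum]
    exact Finset.sum_congr rfl fun α _ => by ring
  · simp only [conformalMetric, mul_assoc, ← Finset.mul_sum]
    field_simp
  · have h : ∑ α, (∑ β, q β ^ 2 / a β) * p α * ((∑ β, q β ^ 2 / a β) * p α) =
        (∑ β, q β ^ 2 / a β) ^ 2 * ∑ α, p α ^ 2 := by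
      rw [Finset.mul_sum]
      exact Finset.sum_congr rfl fun α _ => by ring
    simp only [conformalMetric, dualMoserHamiltonian, h]
    field_simp

/-! ### Closed forms for combinations of the `F_α`. -/

/-- Linear combinations of the `F_α`, with divided differences of the coefficients. -/
theorem sum_mul_dualMoser {n : ℕ} {a : Fin (n + 1) → ℝ} (ha : Function.Injective a)
    (c : Fin (n + 1) → ℝ) (k : Fin (n + 1) → Fin (n + 1) → ℝ)
    (hk : ∀ α β, α ≠ β → c α - c β = k α β * (a α - a β)) (x : Phase n) :
    ∑ α, c α * dualMoser a α x = (∑ α, c α * x.1 α ^ 2) * ∑ α, a α * x.2 α ^ 2 +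
      1 / 2 * ∑ α, ∑ β, k α β * (a α * x.2 α * x.1 β - a β * x.2 β * x.1 α) ^ 2 := by
  have h1 : ∀ α, c α * dualMoser a α x = c α * x.1 α ^ 2 * ∑ β, a β * x.2 β ^ 2 +
      ∑ β, c α * ((a α * x.2 α * x.1 β - a β * x.2 β * x.1 α) ^ 2 / (a α - a β)) := fun α => by
    rw [dualMoser, mul_add, Finset.mul_sum (Finset.univ.erase α),
      ← Finset.add_sum_erase Finset.univ _ (Finset.mem_univ α)]
    simp [mul_assoc]
  simp only [h1, Finset.sum_add_distrib, ← Finset.sum_mul]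
  congr 1
  -- Averaging with the sum in which `α` and `β` are exchanged turns `c α / (a α - a β)` into half
  -- the divided difference.
  have h2 := Finset.sum_comm (s := Finset.univ) (t := Finset.univ) (f := fun α β =>
    c α * ((a α * x.2 α * x.1 β - a β * x.2 β * x.1 α) ^ 2 / (a α - a β)))
  rw [eq_comm, one_div, inv_mul_eq_iff_eq_mul₀ two_ne_zero, two_mul]
  conv_rhs => rhs; rw [h2]
  simp only [← Finset.sum_add_distrib]
  refine Finset.sum_congr rfl fun α _ => Finset.sum_congr rfl fun β _ => ?_
  by_cases h : α = β
  · subst h; simp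
  · have h3 : a α - a β ≠ 0 := sub_ne_zero.2 fun e => h (ha e)
    have h4 : a β - a α ≠ 0 := sub_ne_zero.2 fun e => h (ha e).symm
    have h5 : k α β = (c α - c β) / (a α - a β) := by rw [hk α β h]; field_simp
    rw [h5, ← neg_sub (a α) (a β)]
    field_simp
    ring

theorem sum_sum_mul_wedge_sq {ι : Type*} [Fintype ι] (s t u v : ι → ℝ) :
    ∑ i, ∑ j, s i * t j * (u i * v j - u j * v i) ^ 2 =
      (∑ i, s i * u i ^ 2) * (∑ i, t i * v i ^ 2) + (∑ i, s i * v i ^ 2) * (∑ i, t i * u i ^ 2) -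
        2 * ((∑ i, s i * (u i * v i)) * ∑ i, t i * (u i * v i)) := by
  simp only [Finset.sum_mul_sum]
  simp only [Finset.mul_sum, ← Finset.sum_add_distrib,
    ← Finset.sum_sub_distrib]
  exact Finset.sum_congr rfl fun i _ => Finset.sum_congr rfl fun j _ => by ring

/-- The generating function `∑ F_α / (z - a_α)` in closed form. -/
theorem sum_inv_sub_mul_dualMoser {n : ℕ} {a : Fin (n + 1) → ℝ} (ha : Function.Injective a)
    {z : ℝ} (hz : ∀ α, z ≠ a α) (x : Phase n) :
    ∑ α, (z - a α)⁻¹ * dualMoser a α x =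
      (∑ α, (z - a α)⁻¹ * (x.1 α * x.1 α)) * (∑ α, z * (z - a α)⁻¹ * a α * (x.2 α * x.2 α)) -
        (∑ α, (z - a α)⁻¹ * a α * (x.1 α * x.2 α)) *
          ∑ α, (z - a α)⁻¹ * a α * (x.1 α * x.2 α) := by
  have hne : ∀ α, z - a α ≠ 0 := fun α => sub_ne_zero.2 (hz α)
  rw [sum_mul_dualMoser ha _ (fun α β => (z - a α)⁻¹ * (z - a β)⁻¹) (fun α β _ => by
    have := hne α; have := hne β; field_simp; ring)]
  have h := sum_sum_mul_wedge_sq (fun α => (z - a α)⁻¹) (fun α => (z - a α)⁻¹)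
    (fun α => a α * x.2 α) x.1
  -- Since `z a / (z - a) = a + a² / (z - a)`, `T` absorbs the separate term `∑ a_α p_α²`.
  have hT : ∑ α, z * (z - a α)⁻¹ * a α * (x.2 α * x.2 α) =
      ∑ α, a α * x.2 α ^ 2 + ∑ α, (z - a α)⁻¹ * (a α * x.2 α) ^ 2 := by
    rw [← Finset.sum_add_distrib]
    refine Finset.sum_congr rfl fun α _ => ?_
    have := hne α
    field_simp
    ring
  have hR : ∑ α, (z - a α)⁻¹ * a α * (x.1 α * x.2 α) =
      ∑ α, (z - a α)⁻¹ * (a α * x.2 α * x.1 α) :=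
    Finset.sum_congr rfl fun α _ => by ring
  rw [h, hT, hR]
  simp only [← pow_two]
  ring

/-- The coefficients come from `1 / (z - a) = -1/a - z/a² - ⋯`. At `z = 0` one has `T = 0`, so half
the derivative of `P T - R²` is `½ P T' - R R'`: the first term is `H`, the second is minus the
product of sums added here. -/
theorem dualMoserHamiltonian_eq {n : ℕ} {a : Fin (n + 1) → ℝ} (ha_pos : ∀ α, 0 < a α)
    (ha : Function.Injective a) (x : Phase n) :
    dualMoserHamiltonian a x = ∑ α, -(1 / 2 * ((a α)⁻¹ ^ 2)) * dualMoser a α x +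
      (∑ α, 1 * (x.2 α * x.1 α)) * ∑ α, (a α)⁻¹ * (x.2 α * x.1 α) := by
  have hne : ∀ α, a α ≠ 0 := fun α => (ha_pos α).ne'
  rw [sum_mul_dualMoser ha _ (fun α β => 1 / 2 * ((a α)⁻¹ * (a β)⁻¹ ^ 2) +
    1 / 2 * ((a α)⁻¹ ^ 2 * (a β)⁻¹)) (fun α β _ => by
      have := hne α; have := hne β; field_simp; ring)]
  have h1 := sum_sum_mul_wedge_sq (fun α => (a α)⁻¹) (fun α => (a α)⁻¹ ^ 2)
    (fun α => a α * x.2 α) x.1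
  have h2 := sum_sum_mul_wedge_sq (fun α => (a α)⁻¹ ^ 2) (fun α => (a α)⁻¹)
    (fun α => a α * x.2 α) x.1
  have e1 : ∀ α, (a α)⁻¹ * (a α * x.2 α) ^ 2 = a α * x.2 α ^ 2 := fun α => by
    have := hne α; field_simp
  have e2 : ∀ α, (a α)⁻¹ ^ 2 * (a α * x.2 α) ^ 2 = x.2 α ^ 2 := fun α => by
    have := hne α; field_simp
  have e3 : ∀ α, (a α)⁻¹ * (a α * x.2 α * x.1 α) = x.2 α * x.1 α := fun α => by
    have := hne α; field_simp
  have e4 : ∀ α, (a α)⁻¹ ^ 2 * (a α * x.2 α * x.1 α) = (a α)⁻¹ * (x.2 α * x.1 α) := fun α => by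
    have := hne α; field_simp
  simp only [e1, e2, e3, e4] at h1 h2
  have e5 : ∀ α, -(1 / 2 * ((a α)⁻¹ ^ 2)) * x.1 α ^ 2 =
    -(1 / 2) * ((a α)⁻¹ ^ 2 * x.1 α ^ 2) := fun α => by ring
  simp only [add_mul, mul_assoc (1 / 2 : ℝ), Finset.sum_add_distrib, ← Finset.mul_sum, h1, h2, e5]
  simp only [dualMoserHamiltonian, div_eq_inv_mul, one_mul]
  ring

/-- The extra product has the factor `∑ p_α q_α`, which vanishes on `T*Sⁿ` together with its
differential on tangent vectors. -/
theorem restrictedDifferential_dualMoserHamiltonian {n : ℕ} {a : Fin (n + 1) → ℝ}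
    (ha_pos : ∀ α, 0 < a α) (ha : Function.Injective a) (x : CotangentSphere n) :
    restrictedDifferential (dualMoserHamiltonian a) x =
      ∑ α, -(1 / 2 * ((a α)⁻¹ ^ 2)) • restrictedDifferential (dualMoser a α) x := by
  rw [← restrictedDifferential_sum _ _ _ (differentiable_dualMoser a)]
  ext Y
  have hF := differentiable_dualMoser a
  have hg : Differentiable ℝ
      (fun y => ∑ α, -(1 / 2 * ((a α)⁻¹ ^ 2)) * dualMoser a α y) := by fun_prop
  have hm : Differentiable ℝ (fun y : Phase n =>
      (∑ α, 1 * (y.2 α * y.1 α)) * ∑ α, (a α)⁻¹ * (y.2 α * y.1 α)) := by fun_prop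
  simp only [restrictedDifferential, LinearMap.domRestrict_apply, ContinuousLinearMap.coe_coe]
  rw [funext (dualMoserHamiltonian_eq ha_pos ha), fderiv_fun_add (hg _) (hm _)]
  have h0 := (hasDerivAt_sum_mul_line Finset.univ (fun _ => 1) x.1.2 Y.1.2 x.1.1 Y.1.1).fun_mul
    (hasDerivAt_sum_mul_line Finset.univ (fun α => (a α)⁻¹) x.1.2 Y.1.2 x.1.1 Y.1.1)
  have h1 := fderiv_eq_of_line hm (x := x.1) (Y := Y.1) h0
  rw [_root_.add_apply, h1, add_eq_left]
  have h2 : ∑ α, (Y.1.2 α * x.1.1 α + x.1.2 α * Y.1.1 α) = 0 := by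
    rw [← Y.2.2]
    exact Finset.sum_congr rfl fun α _ => by ring
  have h3 : ∑ α, x.1.2 α * x.1.1 α = 0 := x.2.2
  simp only [zero_mul, add_zero, one_mul, h2, h3]

/-! ### Involution. -/

/-- The Hamiltonian vector fields of the generating functions. -/
theorem coe_hamiltonianVector_generating {n : ℕ} {a : Fin (n + 1) → ℝ}
    (ha : Function.Injective a) {z : ℝ} (hz : ∀ α, z ≠ a α) (x : CotangentSphere n)
    {P T R : ℝ} (hP : ∑ α, (z - a α)⁻¹ * (x.1.1 α * x.1.1 α) = P)
    (hT : ∑ α, z * (z - a α)⁻¹ * a α * (x.1.2 α * x.1.2 α) = T)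
    (hR : ∑ α, (z - a α)⁻¹ * a α * (x.1.1 α * x.1.2 α) = R) :
    (hamiltonianVector (fun y => ∑ α, (z - a α)⁻¹ * dualMoser a α y) x : Phase n) =
      (fun α => 2 * ((z - a α)⁻¹ * a α * (z * P * x.1.2 α - R * x.1.1 α)) - 2 * R * x.1.1 α,
       fun α => -(2 * ((z - a α)⁻¹ * (T * x.1.1 α - R * a α * x.1.2 α))) +
        2 * R * x.1.2 α) := by
  have hne : ∀ α, z - a α ≠ 0 := fun α => sub_ne_zero.2 (hz α)
  have hq : ∑ α, x.1.1 α ^ 2 = 1 := x.2.1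
  have hqq : ∑ α, (z - a α)⁻¹ * a α * (x.1.1 α * x.1.1 α) = z * P - 1 := by
    rw [← hP, ← hq, Finset.mul_sum, ← Finset.sum_sub_distrib]
    refine Finset.sum_congr rfl fun α _ => ?_
    have := hne α
    field_simp
    ring
  -- The ambient Hamiltonian field plus the multiplier term `2R (-q, p)`, the field of `-2R ∑ p_α
  -- q_α` with `R` frozen. It restores tangency to the sphere and does not affect the second
  -- constraint.
  let X : tangentCotangentSphere x := ⟨(fun α => 2 * ((z - a α)⁻¹ * a α *
    (z * P * x.1.2 α - R * x.1.1 α)) - 2 * R * x.1.1 α,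
       fun α => -(2 * ((z - a α)⁻¹ * (T * x.1.1 α - R * a α * x.1.2 α))) +
        2 * R * x.1.2 α), by
    constructor
    · calc _ = ∑ α, (2 * z * P * ((z - a α)⁻¹ * a α * (x.1.1 α * x.1.2 α)) -
            2 * R * ((z - a α)⁻¹ * a α * (x.1.1 α * x.1.1 α)) - 2 * R * x.1.1 α ^ 2) :=
          Finset.sum_congr rfl fun α _ => by ring
        _ = _ := by
          simp only [Finset.sum_sub_distrib, ← Finset.mul_sum, hqq, hR, hq]
          ring
    · calc _ = ∑ α, (2 * P * (z * (z - a α)⁻¹ * a α * (x.1.2 α * x.1.2 α)) -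
            2 * T * ((z - a α)⁻¹ * (x.1.1 α * x.1.1 α))) :=
          Finset.sum_congr rfl fun α _ => by ring
        _ = _ := by
          simp only [Finset.sum_sub_distrib, ← Finset.mul_sum, hP, hT]
          ring⟩
  suffices h : hamiltonianVector (fun y => ∑ α, (z - a α)⁻¹ * dualMoser a α y) x = X by rw [h]
  refine hamiltonianVector_eq fun Y => ?_
  have hF := differentiable_dualMoser a
  have hd : Differentiable ℝ (fun y => ∑ α, (z - a α)⁻¹ * dualMoser a α y) := by fun_prop
  have hl1 := hasDerivAt_sum_mul_line Finset.univ (fun α => (z - a α)⁻¹) x.1.1 Y.1.1 x.1.1 Y.1.1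
  have hl2 := hasDerivAt_sum_mul_line Finset.univ (fun α => z * (z - a α)⁻¹ * a α)
    x.1.2 Y.1.2 x.1.2 Y.1.2
  have hl3 := hasDerivAt_sum_mul_line Finset.univ (fun α => (z - a α)⁻¹ * a α)
    x.1.1 Y.1.1 x.1.2 Y.1.2
  have hl := (hl1.fun_mul hl2).fun_sub (hl3.fun_mul hl3)
  simp only [zero_mul, add_zero, hP, hT, hR] at hl
  have h1 := fderiv_eq_of_line (x := x.1) (Y := Y.1) hd
    (by simp only [sum_inv_sub_mul_dualMoser ha hz]; exact hl)
  rw [h1, symplecticForm_apply]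
  have hY : ∑ α, (x.1.1 α * Y.1.2 α + x.1.2 α * Y.1.1 α) = 0 := Y.2.2
  -- Subtracting `2R` times the constraint on `Y` makes the identity hold summand by summand.
  rw [← sub_eq_zero, ← mul_zero (2 * R), ← hY]
  simp only [Finset.sum_mul, Finset.mul_sum, ← Finset.sum_add_distrib, ← Finset.sum_sub_distrib,
    ← Finset.sum_neg_distrib]
  refine Finset.sum_congr rfl fun α _ => ?_
  simp only [X]
  ring

/-- Put `u = (zP, R, T)` and let `v` be its analogue at `w`. By partial fractions the three mixed
sums, times `w - z`, are the components of `u - v`, while their coefficients in the bracket are, up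
to a factor, those of `u × v`. The bracket vanishes because `(u × v) · (u - v) = 0`. -/
theorem poissonBracket_generating {n : ℕ} {a : Fin (n + 1) → ℝ}
    (ha : Function.Injective a) {z w : ℝ} (hz : ∀ α, z ≠ a α) (hw : ∀ α, w ≠ a α) (hzw : z ≠ w)
    (x : CotangentSphere n) :
    poissonBracket (fun y => ∑ α, (z - a α)⁻¹ * dualMoser a α y)
      (fun y => ∑ α, (w - a α)⁻¹ * dualMoser a α y) x = 0 := by
  obtain ⟨P, hP⟩ : ∃ P, ∑ α, (z - a α)⁻¹ * (x.1.1 α * x.1.1 α) = P := ⟨_, rfl⟩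
  obtain ⟨T, hT⟩ : ∃ T, ∑ α, z * (z - a α)⁻¹ * a α * (x.1.2 α * x.1.2 α) = T := ⟨_, rfl⟩
  obtain ⟨R, hR⟩ : ∃ R, ∑ α, (z - a α)⁻¹ * a α * (x.1.1 α * x.1.2 α) = R := ⟨_, rfl⟩
  obtain ⟨P', hP'⟩ : ∃ P, ∑ α, (w - a α)⁻¹ * (x.1.1 α * x.1.1 α) = P := ⟨_, rfl⟩
  obtain ⟨T', hT'⟩ : ∃ T, ∑ α, w * (w - a α)⁻¹ * a α * (x.1.2 α * x.1.2 α) = T := ⟨_, rfl⟩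
  obtain ⟨R', hR'⟩ : ∃ R, ∑ α, (w - a α)⁻¹ * a α * (x.1.1 α * x.1.2 α) = R := ⟨_, rfl⟩
  have hX := coe_hamiltonianVector_generating ha hz x hP hT hR
  have hX' := coe_hamiltonianVector_generating ha hw x hP' hT' hR'
  have hzne : ∀ α, z - a α ≠ 0 := fun α => sub_ne_zero.2 (hz α)
  have hwne : ∀ α, w - a α ≠ 0 := fun α => sub_ne_zero.2 (hw α)
  have hres : ∀ α, (w - z) * ((z - a α)⁻¹ * (w - a α)⁻¹) = (z - a α)⁻¹ - (w - a α)⁻¹ :=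
    fun α => by
      have := hzne α; have := hwne α
      field_simp
      ring
  have hrz : ∀ α, a α * (z - a α)⁻¹ = z * (z - a α)⁻¹ - 1 := fun α => by
    have := hzne α
    field_simp
    ring
  have hrw : ∀ α, a α * (w - a α)⁻¹ = w * (w - a α)⁻¹ - 1 := fun α => by
    have := hwne α
    field_simp
    ring
  have hqz : ∑ α, (z - a α)⁻¹ * a α * (x.1.1 α * x.1.1 α) = z * P - 1 := by
    rw [← hP, ← x.2.1, Finset.mul_sum, ← Finset.sum_sub_distrib]
    exact Finset.sum_congr rfl fun α _ => by linear_combination (x.1.1 α) ^ 2 * hrz α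
  have hqw : ∑ α, (w - a α)⁻¹ * a α * (x.1.1 α * x.1.1 α) = w * P' - 1 := by
    rw [← hP', ← x.2.1, Finset.mul_sum, ← Finset.sum_sub_distrib]
    exact Finset.sum_congr rfl fun α _ => by linear_combination (x.1.1 α) ^ 2 * hrw α
  have hS1 : (w - z) * ∑ α, (z - a α)⁻¹ * (w - a α)⁻¹ * a α * (x.1.1 α * x.1.2 α) = R - R' := by
    rw [← hR, ← hR', Finset.mul_sum, ← Finset.sum_sub_distrib]
    exact Finset.sum_congr rfl fun α _ => by
      linear_combination a α * (x.1.1 α * x.1.2 α) * hres α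
  have hS2 : (w - z) * ∑ α, (z - a α)⁻¹ * (w - a α)⁻¹ * a α * (x.1.1 α * x.1.1 α) =
      z * P - w * P' := by
    have : z * P - w * P' = (z * P - 1) - (w * P' - 1) := by ring
    rw [this, ← hqz, ← hqw, Finset.mul_sum, ← Finset.sum_sub_distrib]
    exact Finset.sum_congr rfl fun α _ => by
      linear_combination a α * (x.1.1 α * x.1.1 α) * hres α
  have hS3 : (w - z) * ∑ α, (z - a α)⁻¹ * (w - a α)⁻¹ * a α * a α * (x.1.2 α * x.1.2 α) =
      T - T' := by
    rw [← hT, ← hT', Finset.mul_sum, ← Finset.sum_sub_distrib]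
    exact Finset.sum_congr rfl fun α _ => by
      linear_combination a α * a α * (x.1.2 α * x.1.2 α) * hres α +
        a α * (x.1.2 α * x.1.2 α) * (hrz α - hrw α)
  -- The last two groups are zero; they stay as sums so that the identity can be checked termwise.
  have key : poissonBracket (fun y => ∑ α, (z - a α)⁻¹ * dualMoser a α y)
      (fun y => ∑ α, (w - a α)⁻¹ * dualMoser a α y) x =
      4 * (z * P * T' - w * P' * T) *
          ∑ α, (z - a α)⁻¹ * (w - a α)⁻¹ * a α * (x.1.1 α * x.1.2 α) +
        4 * (R' * T - R * T') *
          ∑ α, (z - a α)⁻¹ * (w - a α)⁻¹ * a α * (x.1.1 α * x.1.1 α) +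
        4 * (w * P' * R - z * P * R') *
          ∑ α, (z - a α)⁻¹ * (w - a α)⁻¹ * a α * a α * (x.1.2 α * x.1.2 α) +
        4 * R' * (T * (∑ α, (z - a α)⁻¹ * (x.1.1 α * x.1.1 α)) -
          P * ∑ α, z * (z - a α)⁻¹ * a α * (x.1.2 α * x.1.2 α)) +
        4 * R * (P' * (∑ α, w * (w - a α)⁻¹ * a α * (x.1.2 α * x.1.2 α)) -
          T' * ∑ α, (w - a α)⁻¹ * (x.1.1 α * x.1.1 α)) := by
    rw [poissonBracket, symplecticForm_apply, hX, hX']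
    simp only [Finset.mul_sum, ← Finset.sum_add_distrib, ← Finset.sum_sub_distrib]
    exact Finset.sum_congr rfl fun α _ => by ring
  rw [hP, hT, hP', hT'] at key
  have hzw' : w - z ≠ 0 := sub_ne_zero.2 hzw.symm
  refine (mul_eq_zero.1 ?_).resolve_left hzw'
  rw [key]
  linear_combination 4 * (z * P * T' - w * P' * T) * hS1 + 4 * (R' * T - R * T') * hS2 +
    4 * (w * P' * R - z * P * R') * hS3

theorem poissonBracket_dualMoser {n : ℕ} {a : Fin (n + 1) → ℝ} (ha : Function.Injective a)
    (α β : Fin (n + 1)) (x : CotangentSphere n) :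
    poissonBracket (dualMoser a α) (dualMoser a β) x = 0 := by
  have hX (z : ℝ) : hamiltonianVector (fun y => ∑ α, (z - a α)⁻¹ * dualMoser a α y) x =
      ∑ α, (z - a α)⁻¹ • hamiltonianVector (dualMoser a α) x :=
    hamiltonianVector_eq_sum _ _ _ _ x
      (restrictedDifferential_sum _ _ _ (differentiable_dualMoser a) x)
  refine eq_zero_of_sum_inv_sub_mul ha
    (fun α => poissonBracket (dualMoser a α) (dualMoser a β) x) Set.finite_empty
    (fun z _ hz => ?_) α
  -- Now `z` is fixed and `w` varies; `w = z` is excluded because the partial fractions divide by `w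
  -- - z`.
  refine eq_zero_of_sum_inv_sub_mul ha (fun β =>
    ∑ α, (z - a α)⁻¹ * poissonBracket (dualMoser a α) (dualMoser a β) x) (Set.finite_singleton z)
    (fun w hwz hw => ?_) β
  have h := poissonBracket_generating ha hz hw (Ne.symm hwz) x
  simpa only [poissonBracket, hX, map_sum, map_smul, LinearMap.sum_apply, LinearMap.smul_apply,
    smul_eq_mul] using h

theorem isFirstIntegral_dualMoser {n : ℕ} {a : Fin (n + 1) → ℝ} (ha_pos : ∀ α, 0 < a α)
    (ha : Function.Injective a) (α : Fin (n + 1)) :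
    IsFirstIntegral (dualMoserHamiltonian a) (dualMoser a α) := by
  refine isFirstIntegral_of_differential (differentiable_dualMoser a α) fun x => ?_
  rw [hamiltonianVector_eq_sum _ _ _ _ x
    (restrictedDifferential_dualMoserHamiltonian ha_pos ha x), map_sum]
  refine Finset.sum_eq_zero fun β _ => ?_
  have h := poissonBracket_dualMoser ha α β x
  rw [poissonBracket, symplecticForm_hamiltonianVector, neg_eq_zero] at h
  rw [map_smul, h, smul_zero]

/-! ### Functional independence. -/

/-- The symmetric bilinear form polarizing the quadratic form `p ↦ F_α (q, p)`, which is
`½ ∂F_α/∂p (w)` at `(q, p)`. -/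
noncomputable def dualMoserForm {n : ℕ} (a : Fin (n + 1) → ℝ) (α : Fin (n + 1))
    (q p w : Fin (n + 1) → ℝ) : ℝ :=
  q α ^ 2 * ∑ β, a β * (p β * w β) + ∑ β ∈ Finset.univ.erase α, (a α - a β)⁻¹ *
    ((a α * p α * q β - a β * p β * q α) * (a α * w α * q β - a β * w β * q α))

theorem fderiv_dualMoser_momentum {n : ℕ} (a : Fin (n + 1) → ℝ) (α : Fin (n + 1))
    (x : Phase n) (w : Fin (n + 1) → ℝ) :
    fderiv ℝ (dualMoser a α) x (0, w) = 2 * dualMoserForm a α x.1 x.2 w := by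
  refine fderiv_eq_of_line (differentiable_dualMoser a α) ?_
  have h1 := (hasDerivAt_sum_mul_line Finset.univ a x.2 w x.2 w).const_mul (x.1 α ^ 2)
  have h2 := hasDerivAt_sum_mul_line (Finset.univ.erase α) (fun β => (a α - a β)⁻¹)
    (fun β => a α * x.2 α * x.1 β - a β * x.2 β * x.1 α)
    (fun β => a α * w α * x.1 β - a β * w β * x.1 α)
    (fun β => a α * x.2 α * x.1 β - a β * x.2 β * x.1 α)
    (fun β => a α * w α * x.1 β - a β * w β * x.1 α)
  have hf : (fun t : ℝ => dualMoser a α (x + t • (0, w))) = fun t =>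
      x.1 α ^ 2 * ∑ β, a β * ((x.2 β + t * w β) * (x.2 β + t * w β)) +
      ∑ β ∈ Finset.univ.erase α, (a α - a β)⁻¹ *
        ((a α * x.2 α * x.1 β - a β * x.2 β * x.1 α +
            t * (a α * w α * x.1 β - a β * w β * x.1 α)) *
          (a α * x.2 α * x.1 β - a β * x.2 β * x.1 α +
            t * (a α * w α * x.1 β - a β * w β * x.1 α))) := by
    funext t
    simp only [dualMoser, Prod.fst_add, Prod.snd_add, Prod.smul_mk, smul_zero,
      Pi.zero_apply, add_zero, Pi.add_apply, Pi.smul_apply, smul_eq_mul]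
    congr 1
    · simp only [pow_two]
    · refine Finset.sum_congr rfl fun β _ => ?_
      rw [div_eq_inv_mul]
      ring
  have hd : 2 * dualMoserForm a α x.1 x.2 w =
      x.1 α ^ 2 * ∑ β, a β * (w β * x.2 β + x.2 β * w β) +
      ∑ β ∈ Finset.univ.erase α, (a α - a β)⁻¹ *
        ((a α * w α * x.1 β - a β * w β * x.1 α) * (a α * x.2 α * x.1 β - a β * x.2 β * x.1 α) +
          (a α * x.2 α * x.1 β - a β * x.2 β * x.1 α) *
            (a α * w α * x.1 β - a β * w β * x.1 α)) := by
    rw [dualMoserForm, mul_add, mul_left_comm]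
    simp only [Finset.mul_sum]
    congr 1 <;> exact Finset.sum_congr rfl fun β _ => by ring
  rw [hf, hd]
  exact h1.fun_add h2

theorem dualMoserForm_smul {n : ℕ} (a : Fin (n + 1) → ℝ) (α : Fin (n + 1)) (s : ℝ)
    (q p w : Fin (n + 1) → ℝ) :
    dualMoserForm a α (s • q) p (s ^ 2 • w) = s ^ 4 * dualMoserForm a α q p w := by
  simp only [dualMoserForm, Pi.smul_apply, smul_eq_mul, mul_add]
  simp only [Finset.mul_sum]
  congr 1 <;> exact Finset.sum_congr rfl fun β _ => by ring

/-- The momentum part of the differentials of `(F_α)_{α ≠ γ}` on the projections to `q^⊥` of the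
coordinate vectors other than the `γ`-th. -/
noncomputable def momentumMatrix {n : ℕ} (a : Fin (n + 1) → ℝ) (γ : Fin (n + 1))
    (q p : Fin (n + 1) → ℝ) : Matrix (Fin n) (Fin n) ℝ :=
  Matrix.of fun i j => dualMoserForm a (γ.succAbove i) q p
    (fun β => (∑ δ, q δ ^ 2) * (if β = γ.succAbove j then 1 else 0) - q (γ.succAbove j) * q β)

/-- Up to the factor `2`, the matrix entries are the values of the differentials on vertical tangent
vectors `(0, w)`, so a linear relation among the differentials is a relation among its rows. -/
theorem linearIndependent_of_det_momentumMatrix_ne_zero {n : ℕ} {a : Fin (n + 1) → ℝ}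
    {γ : Fin (n + 1)} {x : CotangentSphere n} (h : (momentumMatrix a γ x.1.1 x.1.2).det ≠ 0) :
    LinearIndependent ℝ
      (fun i : Fin n => restrictedDifferential (dualMoser a (γ.succAbove i)) x) := by
  rw [Fintype.linearIndependent_iff]
  intro c hc
  refine congrFun (Matrix.eq_zero_of_vecMul_eq_zero h (v := c) (funext fun j => ?_))
  have hq : ∑ δ, x.1.1 δ ^ 2 = 1 := x.2.1
  let w : Fin (n + 1) → ℝ := fun β => (∑ δ, x.1.1 δ ^ 2) *
    (if β = γ.succAbove j then 1 else 0) - x.1.1 (γ.succAbove j) * x.1.1 β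
  have hw : ∑ β, x.1.1 β * w β = 0 := by
    have : ∀ β, x.1.1 β * w β = (if β = γ.succAbove j then x.1.1 β else 0) -
        x.1.1 (γ.succAbove j) * x.1.1 β ^ 2 := fun β => by
      simp only [w, hq]
      split_ifs <;> ring
    simp only [this, Finset.sum_sub_distrib, ← Finset.mul_sum, hq, Finset.sum_ite_eq',
      Finset.mem_univ, if_true]
    ring
  let Y : tangentCotangentSphere x := ⟨(0, w), by simp, by simpa using hw⟩
  have h1 := LinearMap.congr_fun hc Y
  have h2 : ∀ α, restrictedDifferential (dualMoser a α) x Y =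
    2 * dualMoserForm a α x.1.1 x.1.2 w := fun α => fderiv_dualMoser_momentum a α x.1 w
  simp only [LinearMap.sum_apply, LinearMap.smul_apply, h2, smul_eq_mul,
    LinearMap.zero_apply, mul_left_comm _ (2 : ℝ), ← Finset.mul_sum] at h1
  exact (mul_eq_zero.1 h1).resolve_left two_ne_zero

/-- The form is quadratic in `q`, and so are the test vectors, thanks to the factor `∑ q_δ²` in
place of `1`. This homogeneity lets `q` leave the unit sphere. -/
theorem momentumMatrix_smul {n : ℕ} (a : Fin (n + 1) → ℝ) (γ : Fin (n + 1)) (s : ℝ)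
    (q p : Fin (n + 1) → ℝ) :
    momentumMatrix a γ (s • q) p = s ^ 4 • momentumMatrix a γ q p := by
  ext i j
  rw [Matrix.smul_apply, smul_eq_mul, momentumMatrix, momentumMatrix, Matrix.of_apply,
    Matrix.of_apply, ← dualMoserForm_smul]
  congr 1
  funext β
  simp only [Pi.smul_apply, smul_eq_mul, mul_pow, ← Finset.mul_sum]
  ring

/-- At `q = e_γ` only `β = γ` contributes, and for `α ≠ γ` the form reduces to `a_α² p_α w_α / (a_α
- a_γ)`: the matrix is diagonal. -/
theorem det_momentumMatrix_single_ne_zero {n : ℕ} {a : Fin (n + 1) → ℝ}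
    (ha_pos : ∀ α, 0 < a α) (ha : Function.Injective a) (γ : Fin (n + 1))
    {p : Fin (n + 1) → ℝ} (hp : ∀ α, α ≠ γ → p α ≠ 0) :
    (momentumMatrix a γ (Pi.single γ 1) p).det ≠ 0 := by
  have h : momentumMatrix a γ (Pi.single γ 1) p = Matrix.diagonal fun i : Fin n =>
      (a (γ.succAbove i) - a γ)⁻¹ * (a (γ.succAbove i) ^ 2 * p (γ.succAbove i)) := by
    ext i j
    have hs : ∑ δ, (Pi.single γ 1 : Fin (n + 1) → ℝ) δ ^ 2 = 1 := by
      rw [Finset.sum_eq_single γ] <;> simp +contextual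
    have hi := Fin.succAbove_ne γ i
    have hj := Fin.succAbove_ne γ j
    rw [momentumMatrix, Matrix.of_apply, dualMoserForm, hs,
      Finset.sum_eq_single_of_mem γ (Finset.mem_erase.2 ⟨hi.symm, Finset.mem_univ _⟩)]
    · by_cases hij : i = j
      · subst hij
        simp only [Matrix.diagonal_apply_eq, Pi.single_eq_same, Pi.single_eq_of_ne hi]
        simp only [if_true, if_neg hi.symm]
        ring
      · have : γ.succAbove i ≠ γ.succAbove j := fun e => hij (Fin.succAbove_right_injective e)
        simp [hi, hj, hj.symm, hij, this]
    · intro β _ hβ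
      simp [hi, hβ]
  rw [h, Matrix.det_diagonal]
  refine Finset.prod_ne_zero_iff.2 fun i _ => ?_
  have hi := Fin.succAbove_ne γ i
  exact mul_ne_zero (inv_ne_zero (sub_ne_zero.2 fun e => hi (ha e)))
    (mul_ne_zero (pow_ne_zero _ (ha_pos _).ne') (hp _ hi))

theorem analyticAt_det {𝕜 E ι : Type*} [NontriviallyNormedField 𝕜] [NormedAddCommGroup E]
    [NormedSpace 𝕜 E] [Fintype ι] [DecidableEq ι] {M : E → Matrix ι ι 𝕜} {x : E}
    (h : ∀ i j, AnalyticAt 𝕜 (fun y => M y i j) x) : AnalyticAt 𝕜 (fun y => (M y).det) x := by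
  simp only [Matrix.det_apply']
  refine Finset.analyticAt_fun_sum _ fun σ _ => ?_
  exact analyticAt_const.mul (Finset.analyticAt_fun_prod _ fun i _ => h _ _)

theorem analyticAt_momentumMatrix {n : ℕ} (a : Fin (n + 1) → ℝ) (γ : Fin (n + 1))
    {q p : ℝ → Fin (n + 1) → ℝ} {t : ℝ} (hq : ∀ α, AnalyticAt ℝ (fun s => q s α) t)
    (hp : ∀ α, AnalyticAt ℝ (fun s => p s α) t) (i j : Fin n) :
    AnalyticAt ℝ (fun s => momentumMatrix a γ (q s) (p s) i j) t := by
  simp only [momentumMatrix, dualMoserForm, Matrix.of_apply]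
  fun_prop

theorem continuous_det_momentumMatrix {n : ℕ} (a : Fin (n + 1) → ℝ) (γ : Fin (n + 1)) :
    Continuous fun x : CotangentSphere n => (momentumMatrix a γ x.1.1 x.1.2).det := by
  refine Continuous.matrix_det (continuous_matrix fun i j => ?_)
  simp only [momentumMatrix, dualMoserForm, Matrix.of_apply]
  fun_prop

/-- The component of `p` orthogonal to `q`, scaled by `∑ q_α²`. -/
def orthogonalComponent {n : ℕ} (q p : Fin (n + 1) → ℝ) : Fin (n + 1) → ℝ :=
  fun α => (∑ β, q β ^ 2) * p α - (∑ β, p β * q β) * q α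

/-- The point of `T*Sⁿ` obtained by rescaling `q` and projecting `p`. -/
theorem normalize_mem_cotangentSphere {n : ℕ} {q : Fin (n + 1) → ℝ} (p : Fin (n + 1) → ℝ)
    (hq : 0 < ∑ α, q α ^ 2) :
    (((√(∑ α, q α ^ 2))⁻¹ • q, orthogonalComponent q p) : Phase n) ∈ CotangentSphere n := by
  constructor
  · simp only [Pi.smul_apply, smul_eq_mul, mul_pow, ← Finset.mul_sum, inv_pow,
      Real.sq_sqrt hq.le]
    exact inv_mul_cancel₀ hq.ne'
  · calc _ = ∑ α, (√(∑ α, q α ^ 2))⁻¹ * ((∑ β, q β ^ 2) * (p α * q α) -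
          (∑ β, p β * q β) * q α ^ 2) :=
        Finset.sum_congr rfl fun α _ => by
          simp only [orthogonalComponent, Pi.smul_apply, smul_eq_mul]
          ring
      _ = 0 := by
        simp only [← Finset.mul_sum, Finset.sum_sub_distrib]
        ring

theorem dense_det_momentumMatrix_ne_zero {n : ℕ} {a : Fin (n + 1) → ℝ}
    (ha_pos : ∀ α, 0 < a α) (ha : Function.Injective a) (γ : Fin (n + 1)) :
    Dense {x : CotangentSphere n | (momentumMatrix a γ x.1.1 x.1.2).det ≠ 0} := by
  rintro ⟨⟨q₀, p₀⟩, h₀⟩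
  have hq₀ : ∑ α, q₀ α ^ 2 = 1 := h₀.1
  have hp₀ : ∑ α, p₀ α * q₀ α = 0 := h₀.2
  -- A straight line in the ambient space, ending at `q = e_γ` with `p_α = 1` for `α ≠ γ`. It may
  -- pass through `q = 0`, so the determinant is taken without normalizing `q`, which keeps it
  -- polynomial in `t`.
  let q : ℝ → Fin (n + 1) → ℝ := fun t α => (1 - t) * q₀ α + t * (Pi.single γ 1 : _ → ℝ) α
  let p : ℝ → Fin (n + 1) → ℝ := fun t α => (1 - t) * p₀ α + t * (if α = γ then 0 else 1)
  have hq0 : q 0 = q₀ := by funext α; simp [q]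
  have hp0 : p 0 = p₀ := by funext α; simp [p]
  have hq1 : q 1 = Pi.single γ 1 := by funext α; simp [q]
  have hp1 : p 1 = fun α => if α = γ then 0 else 1 := by funext α; simp [p]
  let f : ℝ → ℝ := fun t => (momentumMatrix a γ (q t) (orthogonalComponent (q t) (p t))).det
  have hf : AnalyticOnNhd ℝ f Set.univ := fun t _ => by
    have hqa : ∀ α, AnalyticAt ℝ (fun s => q s α) t := fun α => by simp only [q]; fun_prop
    have hpa : ∀ α, AnalyticAt ℝ (fun s => p s α) t := fun α => by simp only [p]; fun_prop
    refine analyticAt_det (analyticAt_momentumMatrix a γ hqa fun α => ?_)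
    simp only [orthogonalComponent]
    fun_prop
  have hf1 : f 1 ≠ 0 := by
    simp only [f, hq1]
    refine det_momentumMatrix_single_ne_zero ha_pos ha γ fun α hα => ?_
    have hs : ∑ δ, (Pi.single γ 1 : Fin (n + 1) → ℝ) δ ^ 2 = 1 := by
      rw [Finset.sum_eq_single γ] <;> simp +contextual
    simp [orthogonalComponent, hs, hp1, hα]
  -- Identity theorem: vanishing near `0` would propagate to `t = 1`; otherwise the zeros are
  -- isolated.
  have hev : ∀ᶠ t in nhdsWithin 0 {(0 : ℝ)}ᶜ, f t ≠ 0 := by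
    refine (hf 0 trivial).eventually_eq_zero_or_eventually_ne_zero.resolve_left fun h => hf1 ?_
    exact hf.eqOn_zero_of_preconnected_of_eventuallyEq_zero isPreconnected_univ trivial h trivial
  have hqc : Continuous q := by fun_prop
  have hpc : Continuous p := by
    refine continuous_pi fun α => ?_
    simp only [p]
    fun_prop
  have hsum : Continuous fun t => ∑ α, q t α ^ 2 := by fun_prop
  have hpos : ∀ᶠ t in nhdsWithin 0 {(0 : ℝ)}ᶜ, 0 < ∑ α, q t α ^ 2 := by
    refine Filter.Eventually.filter_mono nhdsWithin_le_nhds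
      (hsum.continuousAt.eventually (lt_mem_nhds ?_))
    simp only [hq0, hq₀]
    exact one_pos
  let g : ℝ → Phase n := fun t =>
    ((√(∑ α, q t α ^ 2))⁻¹ • q t, orthogonalComponent (q t) (p t))
  have hg : Filter.Tendsto g (nhdsWithin 0 {(0 : ℝ)}ᶜ) (nhds (q₀, p₀)) := by
    have hg0 : g 0 = (q₀, p₀) := by
      simp only [g, hq0, hp0, hq₀, Real.sqrt_one, inv_one, one_smul, Prod.mk.injEq, true_and]
      funext α
      simp [orthogonalComponent, hq₀, hp₀]
    rw [← hg0]
    refine ContinuousAt.continuousWithinAt (ContinuousAt.prodMk ?_ ?_)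
    · refine ContinuousAt.smul (ContinuousAt.inv₀ hsum.sqrt.continuousAt ?_) hqc.continuousAt
      rw [hq0, hq₀, Real.sqrt_one]
      exact one_ne_zero
    · refine Continuous.continuousAt (continuous_pi fun α => ?_)
      simp only [orthogonalComponent]
      fun_prop
  rw [mem_closure_iff_nhds]
  intro V hV
  obtain ⟨W, hW, hWV⟩ := mem_nhds_subtype _ _ _ |>.1 hV
  obtain ⟨t, ⟨htf, htq⟩, htW⟩ := ((hev.and hpos).and (hg hW)).exists
  refine ⟨⟨g t, normalize_mem_cotangentSphere (p t) htq⟩, hWV htW, ?_⟩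
  change (momentumMatrix a γ ((√(∑ α, q t α ^ 2))⁻¹ • q t) _).det ≠ 0
  -- Normalizing `q` only multiplies the determinant by a nonzero factor.
  rw [momentumMatrix_smul, Matrix.det_smul]
  exact mul_ne_zero (pow_ne_zero _ (pow_ne_zero _ (inv_ne_zero (Real.sqrt_pos.2 htq).ne'))) htf

theorem functionallyIndependent_dualMoser {n : ℕ} {a : Fin (n + 1) → ℝ}
    (ha_pos : ∀ α, 0 < a α) (ha : Function.Injective a) (γ : Fin (n + 1)) :
    FunctionallyIndependent (fun i : Fin n => dualMoser a (γ.succAbove i)) :=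
  ⟨_, isOpen_compl_singleton.preimage (continuous_det_momentumMatrix a γ),
    dense_det_momentumMatrix_ne_zero ha_pos ha γ,
    fun _ hx => linearIndependent_of_det_momentumMatrix_ne_zero hx⟩

theorem theorem1p1 (n : ℕ) (a : Fin (n + 1) → ℝ) (ha_pos : ∀ α, 0 < a α)
    (ha_inj : Function.Injective a) :
    IsGeodesicHamiltonian a (dualMoserHamiltonian a) ∧
    IsLiouvilleIntegrable (dualMoserHamiltonian a) ∧
    (∀ α, IsFirstIntegral (dualMoserHamiltonian a) (dualMoser a α)) ∧
    (∀ α β, ∀ x : CotangentSphere n, poissonBracket (dualMoser a α) (dualMoser a β) x = 0) ∧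
    (∀ γ : Fin (n + 1), IsLiouvilleIntegrableBy (dualMoserHamiltonian a)
      (fun i : Fin n => dualMoser a (γ.succAbove i))) := by
  have h : ∀ γ : Fin (n + 1), IsLiouvilleIntegrableBy (dualMoserHamiltonian a)
      (fun i : Fin n => dualMoser a (γ.succAbove i)) := fun γ =>
    { smooth_hamiltonian := contDiff_dualMoserHamiltonian a
      smooth := fun _ => contDiff_dualMoser a _
      firstIntegral := fun _ => isFirstIntegral_dualMoser ha_pos ha_inj _
      involution := fun _ _ => poissonBracket_dualMoser ha_inj _ _
      independent := functionallyIndependent_dualMoser ha_pos ha_inj γ }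
  exact ⟨isGeodesicHamiltonian_dualMoserHamiltonian ha_pos, ⟨_, h 0⟩,
    isFirstIntegral_dualMoser ha_pos ha_inj, poissonBracket_dualMoser ha_inj, h⟩
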